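/- Let $I$ be a nonempty set, let $H$ be a real Hilbert space, and for each $i\in I$ let $C_i\subseteq H$ be nonempty, compact and convex. For each $i\in I$ let $\{T_{t,i}\}_{t\ge 0}$ be a representation of $\mathbb R^+=[0,\infty)$ as nonexpansive mappings of $C_i$ into itself, that is, $T_{s+t,i}x=T_{s,i}T_{t,i}x$ and $\|T_{t,i}x-T_{t,i}y\|\le\|x-y\|$ for all $s,t\ge0$, $x,y\in C_i$, and assume that the set of common fixed points $\mathrm{Fix}(\mathcal S_i)=\{x\in C_i: T_{t,i}x=x \text{ for all } t\ge 0\}$ is nonempty. Let $X$ be a linear subspace of the space $C(\mathbb R^+)$ of bounded continuous real-valued functions on $\mathbb R^+$ that contains the constant function $1$, is left invariant ($t\mapsto g(s+t)$ is in $X$ for all $g\in X$, $s\ge0$), and contains the function $t\mapsto\langle T_{t,i}x,y\rangle$ for all $i\in I$, $x\in C_i$, $y\in H$. For each $i\in I$ let $f_i:C_i\to C_i$ be an $\alpha_i$-contraction, that is, $\|f_i(x)-f_i(y)\|\le\alpha_i\|x-y\|$ for all $x,y\in C_i$, where $0\le\alpha_i<1$. Let $\epsilon_n\in(0,1)$ with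 $\epsilon_n\to0$, and let $a_n\in(0,\infty)$ with $a_n\to\infty$. Then for each $i\in I$ there is a unique sunny nonexpansive retraction $P_i$ of $C_i$ onto $\mathrm{Fix}(\mathcal S_i)$, that is, a unique nonexpansive map $P_i:C_i\to \mathrm{Fix}(\mathcal S_i)$ such that $P_ix=x$ for all $x\in\mathrm{Fix}(\mathcal S_i)$ and $P_i(P_ix+t(x-P_ix))=P_ix$ whenever $x\in C_i$, $t\ge0$ and $P_ix+t(x-P_ix)\in C_i$; there is a unique point $x_i\in C_i$ with $f_i(P_ix_i)=x_i$; and for all $n\in\mathbb N$ and $i\in I$ there is a unique point $z_{n,i}\in C_i$ with $$z_{n,i}=\epsilon_n f_i(z_{n,i})+(1-\epsilon_n)\frac1{a_n}\int_0^{a_n}T_{t,i}z_{n,i}\,dt .$$ Moreover, the functions $g_n:I\to H$, $g_n(i)=z_{n,i}$, converge to the function $g:I\to H$, $g(i)=P_ix_i$, in the product topology on $H^I$ generated by the norm topology of $H$. -/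

import Mathlib

open scoped NNReal BoundedContinuousFunction RealInnerProductSpace

/-- A representation of the additive semigroup `[0, ∞)` as nonexpansive mappings from `C` into
itself: `T (s + t) x = T s (T t x)`, and every `T s` is nonexpansive.
(As usual for representations of a semigroup, `T 0 = id` is not required.) -/
structure IsNonexpansiveRep {H : Type*} [NormedAddCommGroup H] {C : Set H}
    (T : ℝ≥0 → C → C) : Prop where
  map_add : ∀ (s t : ℝ≥0) (x : C), T (s + t) x = T s (T t x)
  nonexpansive : ∀ (s : ℝ≥0) (x y : C), ‖(T s x : H) - (T s y : H)‖ ≤ ‖(x : H) - (y : H)‖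

/-- The set of common fixed points of a family of self-mappings of `C`. -/
def commonFix {H : Type*} {C : Set H} (T : ℝ≥0 → C → C) : Set C :=
  {x | ∀ t, T t x = x}

/-- `P` is a sunny nonexpansive retraction of `C` onto its subset `D`. -/
structure IsSunnyNonexpansiveRetraction {H : Type*} [NormedAddCommGroup H] [NormedSpace ℝ H]
    {C : Set H} (D : Set C) (P : C → C) : Prop where
  mem : ∀ x, P x ∈ D
  retract : ∀ x ∈ D, P x = x
  nonexpansive : ∀ x y : C, ‖(P x : H) - (P y : H)‖ ≤ ‖(x : H) - (y : H)‖
  sunny : ∀ (x : C) (t : ℝ), 0 ≤ t →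
    ∀ h : (P x : H) + t • ((x : H) - (P x : H)) ∈ C,
      P ⟨(P x : H) + t • ((x : H) - (P x : H)), h⟩ = P x

/-- A subspace `X` of the bounded continuous functions on `[0, ∞)` is left invariant if it is
stable under the translations `g ↦ (t ↦ g (s + t))`. -/
def IsLeftInvariantSubspace (X : Submodule ℝ (ℝ≥0 →ᵇ ℝ)) : Prop :=
  ∀ s : ℝ≥0, ∀ g ∈ X, ∃ g' ∈ X, ∀ t, g' t = g (s + t)

/-- The integral mean `(1 / a) ∫₀ᵃ T t x dt`.  On the range of integration `t ≥ 0`, so that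
`t.toNNReal` is `t` itself. -/
noncomputable def integralMean {H : Type*} [NormedAddCommGroup H] [NormedSpace ℝ H]
    {C : Set H} (T : ℝ≥0 → C → C) (a : ℝ) (x : C) : H :=
  (1 / a) • ∫ t in (0 : ℝ)..a, (T t.toNNReal x : H)

/-- `w` solves the implicit equation `w = ε f(w) + (1 - ε) (1 / a) ∫₀ᵃ T t w dt`. -/
def IsImplicitPoint {H : Type*} [NormedAddCommGroup H] [NormedSpace ℝ H]
    {C : Set H} (f : C → C) (T : ℝ≥0 → C → C) (ε a : ℝ) (w : C) : Prop :=
  (w : H) = ε • (f w : H) + (1 - ε) • integralMean T a w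

/-!
For a single index `i`, the retraction is the metric projection onto the common fixed point set,
which is closed and convex in a Hilbert space. It is characterised by the variational inequality
`⟪x - P x, y - P x⟫ ≤ 0` for every fixed point `y`, and every sunny nonexpansive retraction
satisfies this inequality (`IsSunnyNonexpansiveRetraction.isNearest`), whence uniqueness. Since
`f ∘ P` and `w ↦ ε f w + (1 - ε) M w`, with `M` the integral mean over `[0, a]`, are contractions
of `C`, the points `x` and `z n` come from Banach's fixed point theorem.

For the convergence, the mean `u` of an orbit minimises the mean square distance to the orbit, with
an excess of exactly `‖u - v‖ ^ 2` at any other point `v`. Taking `v = T s u`, and using that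
`T s` shifts the orbit along itself and is nonexpansive, gives `‖T s u - u‖ ^ 2 ≤ s * diam C ^ 2 / a`
(`norm_apply_integralMean_sub_sq_le`), uniformly in the starting point. So `z n` is asymptotically
fixed by every `T s`, and each cluster point `c` of `z n` is a common fixed point. Moreover
`⟪f (z n) - z n, q - z n⟫ ≤ 0` for every common fixed point `q` (`inner_le_zero_of_isImplicitPoint`);
in the limit this says that `c` is the projection of `f c`, which forces `c = P x`. Compactness of
`C` then yields convergence.
-/

open Filter Topology

/-! ### Self-maps of a subset of a normed space -/

section Normed

variable {E : Type*} [NormedAddCommGroup E] {C : Set E}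

theorem ContractingWith.norm_coe_sub_le {K : ℝ≥0} {f : C → C} (hf : ContractingWith K f)
    (x y : C) : ‖(f x : E) - f y‖ ≤ K * ‖(x : E) - y‖ := by
  simpa [Subtype.dist_eq, dist_eq_norm] using hf.toLipschitzWith.dist_le_mul x y

theorem IsNonexpansiveRep.continuous {T : ℝ≥0 → C → C} (hT : IsNonexpansiveRep T) (s : ℝ≥0) :
    Continuous (T s) := by
  have : LipschitzWith 1 (T s) := LipschitzWith.of_dist_le_mul fun x y => by
    simpa [Subtype.dist_eq, dist_eq_norm] using hT.nonexpansive s x y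
  exact this.continuous

theorem isComplete_commonFix {T : ℝ≥0 → C → C} (hC : IsCompact C) (hT : IsNonexpansiveRep T) :
    IsComplete (Subtype.val '' commonFix T) := by
  have := isCompact_iff_compactSpace.1 hC
  have hcl : IsClosed (commonFix T) := by
    simp only [commonFix, Set.ofPred_forall]
    exact isClosed_iInter fun s => isClosed_eq (hT.continuous s) continuous_id
  exact (hcl.isCompact.image continuous_subtype_val).isComplete

theorem continuous_orbit {T : ℝ≥0 → C → C} (hc : ∀ x, Continuous fun t => T t x) (x : C) :
    Continuous fun t : ℝ => (T t.toNNReal x : E) :=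
  continuous_subtype_val.comp ((hc x).comp continuous_real_toNNReal)

end Normed

section Hilbert

variable {H : Type*} [NormedAddCommGroup H] [InnerProductSpace ℝ H] {C : Set H}

/-! ### Nearest points and sunny retractions -/

/-- `p` is the point of `D` nearest to `x`, expressed by the variational inequality that
characterises nearest points of convex sets. -/
def IsNearest (D : Set C) (x : H) (p : C) : Prop :=
  p ∈ D ∧ ∀ y ∈ D, ⟪x - (p : H), (y : H) - (p : H)⟫ ≤ 0

theorem IsNearest.norm_sub_le {D : Set C} {x y : H} {p q : C} (hp : IsNearest D x p)
    (hq : IsNearest D y q) : ‖(p : H) - q‖ ≤ ‖x - y‖ := by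
  have h1 := hp.2 q hq.1
  have h2 := hq.2 p hp.1
  have h3 : ⟪(p : H) - q, (p : H) - q⟫ ≤ ⟪x - y, (p : H) - q⟫ := by
    simp only [inner_sub_left, inner_sub_right] at *
    linarith
  have h4 := real_inner_le_norm (x - y) ((p : H) - q)
  rw [real_inner_self_eq_norm_sq] at h3
  by_contra! h
  nlinarith [norm_nonneg (x - y), norm_nonneg ((p : H) - q)]

theorem IsNearest.eq {D : Set C} {x : H} {p q : C} (hp : IsNearest D x p)
    (hq : IsNearest D x q) : p = q := by
  have h := hp.norm_sub_le hq
  rw [sub_self, norm_zero, norm_le_zero_iff, sub_eq_zero] at h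
  exact Subtype.ext h

theorem exists_isNearest {D : Set C} (hne : D.Nonempty)
    (hcomp : IsComplete (Subtype.val '' D)) (hconv : Convex ℝ (Subtype.val '' D)) (x : H) :
    ∃ p, IsNearest D x p := by
  obtain ⟨v, ⟨p, hp, rfl⟩, hv⟩ :=
    exists_norm_eq_iInf_of_complete_convex (hne.image _) hcomp hconv x
  refine ⟨p, hp, fun y hy => ?_⟩
  exact (norm_eq_iInf_iff_real_inner_le_zero hconv ⟨p, hp, rfl⟩).1 hv y ⟨y, hy, rfl⟩

theorem isSunnyNonexpansiveRetraction_of_isNearest {D : Set C} {P : C → C}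
    (hP : ∀ x : C, IsNearest D x (P x)) : IsSunnyNonexpansiveRetraction D P where
  mem x := (hP x).1
  retract x hx := (hP x).eq ⟨hx, fun y _ => by simp⟩
  nonexpansive x y := (hP x).norm_sub_le (hP y)
  sunny x t ht h := by
    refine (hP _).eq ⟨(hP x).1, fun y hy => ?_⟩
    simpa [real_inner_smul_left] using
      mul_nonpos_of_nonneg_of_nonpos ht ((hP x).2 y hy)

/-- A sunny nonexpansive retraction is the metric projection: `Q` sends the whole segment
from `Q x` to `x` to `Q x`, so the distance to `y ∈ D` cannot decrease at first order
when leaving `Q x` towards `x`. -/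
theorem IsSunnyNonexpansiveRetraction.isNearest {D : Set C} {Q : C → C} (hC : Convex ℝ C)
    (hQ : IsSunnyNonexpansiveRetraction D Q) (x : C) : IsNearest D x (Q x) := by
  refine ⟨hQ.mem x, fun y hy => ?_⟩
  set q : H := (Q x).1
  have key : ∀ t : ℝ, t ∈ Set.Ioc (0 : ℝ) 1 →
      2 * ⟪(x : H) - q, (y : H) - q⟫ ≤ t * ‖(x : H) - q‖ ^ 2 := by
    intro t ht
    have hmem : q + t • ((x : H) - q) ∈ C :=
      hC.add_smul_sub_mem (Q x).2 x.2 ⟨ht.1.le, ht.2⟩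
    have h1 := hQ.nonexpansive ⟨_, hmem⟩ y
    rw [hQ.sunny x t ht.1.le hmem, hQ.retract y hy] at h1
    have h2 : ‖(y : H) - q‖ ^ 2 ≤ ‖((y : H) - q) - t • ((x : H) - q)‖ ^ 2 := by
      rw [norm_sub_rev (y : H) q,
        show ((y : H) - q) - t • ((x : H) - q) = -((q + t • ((x : H) - q)) - y) by abel,
        norm_neg]
      gcongr
    rw [norm_sub_sq_real ((y : H) - q), real_inner_smul_right, norm_smul, Real.norm_eq_abs, mul_pow, sq_abs,
      real_inner_comm] at h2
    have h3 : t * (2 * ⟪(x : H) - q, (y : H) - q⟫) ≤ t * (t * ‖(x : H) - q‖ ^ 2) := by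
      linarith
    exact le_of_mul_le_mul_left h3 ht.1
  have hlim : Tendsto (fun t : ℝ => t * ‖(x : H) - q‖ ^ 2) (𝓝[>] 0) (𝓝 0) := by
    have : Continuous fun t : ℝ => t * ‖(x : H) - q‖ ^ 2 := by fun_prop
    simpa using (this.tendsto 0).mono_left nhdsWithin_le_nhds
  have := ge_of_tendsto hlim
    (eventually_of_mem (Ioc_mem_nhdsGT one_pos) key)
  linarith

/-! ### Convexity of the common fixed point set -/

/-- Stewart's identity. -/
theorem norm_sub_convexComb_sq (x y w : H) {a b : ℝ} (hab : a + b = 1) :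
    ‖w - (a • x + b • y)‖ ^ 2
      = a * ‖w - x‖ ^ 2 + b * ‖w - y‖ ^ 2 - a * b * ‖x - y‖ ^ 2 := by
  obtain rfl : a = 1 - b := by linarith
  simp only [← real_inner_self_eq_norm_sq, inner_sub_left, inner_sub_right, inner_add_left,
    inner_add_right, real_inner_smul_left, real_inner_smul_right, real_inner_comm x w,
    real_inner_comm y w, real_inner_comm y x]
  ring

theorem convex_commonFix {T : ℝ≥0 → C → C} (hC : Convex ℝ C) (hT : IsNonexpansiveRep T) :
    Convex ℝ (Subtype.val '' commonFix T) := by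
  rintro _ ⟨x, hx, rfl⟩ _ ⟨y, hy, rfl⟩ a b ha hb hab
  refine ⟨⟨_, hC x.2 y.2 ha hb hab⟩, fun s => ?_, rfl⟩
  set z : C := ⟨a • (x : H) + b • (y : H), hC x.2 y.2 ha hb hab⟩ with hz
  have h1 := hT.nonexpansive s z x
  have h2 := hT.nonexpansive s z y
  rw [hx s] at h1
  rw [hy s] at h2
  -- `T s z` is no farther from `x` and `y` than `z`, hence at distance at most `0` from `z`.
  have e1 := norm_sub_convexComb_sq (x : H) y (T s z) hab
  have e2 := norm_sub_convexComb_sq (x : H) y z hab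
  have hzc : (z : H) = a • (x : H) + b • (y : H) := rfl
  rw [← hzc] at e1 e2
  rw [sub_self, norm_zero] at e2
  have i1 : a * ‖(T s z : H) - x‖ ^ 2 ≤ a * ‖(z : H) - x‖ ^ 2 := by gcongr
  have i2 : b * ‖(T s z : H) - y‖ ^ 2 ≤ b * ‖(z : H) - y‖ ^ 2 := by gcongr
  have h0 : ‖(T s z : H) - z‖ ^ 2 ≤ 0 := by linarith
  have h0' : ‖(T s z : H) - z‖ = 0 := by
    simpa using le_antisymm h0 (sq_nonneg _)
  exact Subtype.ext (sub_eq_zero.1 (norm_eq_zero.1 h0'))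

/-! ### Integral means of orbits -/

/-- On a compact set the weak and the norm topology agree. -/
theorem continuous_of_forall_continuous_inner {Y : Type*} [TopologicalSpace Y] (hC : IsCompact C)
    {g : Y → C} (hg : ∀ y : H, Continuous fun t => ⟪(g t : H), y⟫) : Continuous g := by
  have := isCompact_iff_compactSpace.1 hC
  let e : C → H → ℝ := fun x y => ⟪(x : H), y⟫
  have he : Continuous e := by fun_prop
  have hinj : Function.Injective e := fun x y h =>
    Subtype.ext (ext_inner_right ℝ fun v => congrFun h v)
  exact (he.isClosedEmbedding hinj).isEmbedding.continuous_iff.2 (continuous_pi hg)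

variable {T : ℝ≥0 → C → C}

theorem norm_integralMean_sub_le (hT : IsNonexpansiveRep T)
    (hc : ∀ x, Continuous fun t => T t x) {a : ℝ} (ha : 0 < a) (x y : C) :
    ‖integralMean T a x - integralMean T a y‖ ≤ ‖(x : H) - y‖ := by
  have h := intervalIntegral.norm_integral_le_of_norm_le_const (a := 0) (b := a)
    (f := fun t : ℝ => (T t.toNNReal x : H) - T t.toNNReal y) (C := ‖(x : H) - y‖)
    fun t _ => hT.nonexpansive _ x y
  rw [intervalIntegral.integral_sub ((continuous_orbit hc x).intervalIntegrable _ _)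
    ((continuous_orbit hc y).intervalIntegrable _ _), sub_zero, abs_of_pos ha] at h
  rw [integralMean, integralMean, ← smul_sub, norm_smul, Real.norm_eq_abs,
    abs_of_pos (by positivity)]
  calc 1 / a * _ ≤ 1 / a * (‖(x : H) - y‖ * a) := by gcongr
    _ = _ := by field_simp

variable [CompleteSpace H]

theorem integralMean_mem (hC : IsCompact C) (hconv : Convex ℝ C)
    (hc : ∀ x, Continuous fun t => T t x) {a : ℝ} (ha : 0 < a) (x : C) :
    integralMean T a x ∈ C := by
  have h := hconv.set_average_mem (μ := MeasureTheory.volume) (t := Set.uIoc 0 a)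
    (f := fun t : ℝ => (T t.toNNReal x : H)) hC.isClosed
    (by simp [Set.uIoc_of_le ha.le, ha]) (by simp [Set.uIoc_of_le ha.le])
    (Eventually.of_forall fun t => (T t.toNNReal x).2)
    (((continuous_orbit hc x).intervalIntegrable 0 a).def')
  rwa [interval_average_eq, sub_zero, ← one_div] at h

theorem integralMean_of_mem_commonFix {a : ℝ} (ha : 0 < a) {q : C} (hq : q ∈ commonFix T) :
    integralMean T a q = q := by
  simp only [integralMean, hq _, intervalIntegral.integral_const, sub_zero, smul_smul]
  rw [one_div_mul_cancel ha.ne', one_smul]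

/-- The mean `u` of `φ` minimises the integral of `‖φ t - v‖ ^ 2` over `v`, and the excess is
`a * ‖u - v‖ ^ 2`. -/
theorem integral_norm_sub_sq_eq {φ : ℝ → H} (hφ : Continuous φ) {a : ℝ} (ha : 0 < a) {u : H}
    (hu : u = (1 / a) • ∫ t in (0 : ℝ)..a, φ t) (v : H) :
    ∫ t in (0 : ℝ)..a, ‖φ t - v‖ ^ 2
      = (∫ t in (0 : ℝ)..a, ‖φ t - u‖ ^ 2) + a * ‖u - v‖ ^ 2 := by
  have hzero : ∫ t in (0 : ℝ)..a, ⟪u - v, φ t - u⟫ = 0 := by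
    have h := (innerSL ℝ (u - v)).intervalIntegral_comp_comm
      (a := 0) (b := a) (μ := MeasureTheory.volume) (f := fun t => φ t - u)
      ((hφ.sub continuous_const).intervalIntegrable _ _)
    simp only [innerSL_apply_apply] at h
    rw [h, intervalIntegral.integral_sub (hφ.intervalIntegrable _ _) (by simp),
      intervalIntegral.integral_const, sub_zero]
    have : ∫ t in (0 : ℝ)..a, φ t = a • u := by
      rw [hu, smul_smul, mul_one_div_cancel ha.ne', one_smul]
    rw [this, sub_self, inner_zero_right]
  have hpt : ∀ t, ‖φ t - v‖ ^ 2 = ‖φ t - u‖ ^ 2 + (2 * ⟪u - v, φ t - u⟫ + ‖u - v‖ ^ 2) := by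
    intro t
    rw [show φ t - v = (φ t - u) + (u - v) by abel, norm_add_sq_real, real_inner_comm]
    ring
  simp only [hpt]
  rw [intervalIntegral.integral_add, intervalIntegral.integral_add,
    intervalIntegral.integral_const_mul, hzero, intervalIntegral.integral_const]
  · simp
  all_goals exact Continuous.intervalIntegrable (by fun_prop) _ _

/-- Integral means over long intervals are almost fixed, uniformly in the starting point. -/
theorem norm_apply_integralMean_sub_sq_le (hC : IsCompact C) (hT : IsNonexpansiveRep T)
    (hc : ∀ x, Continuous fun t => T t x) {a : ℝ} (ha : 0 < a) (s : ℝ≥0) (hs : (s : ℝ) ≤ a)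
    (x u : C) (hu : (u : H) = integralMean T a x) :
    ‖(T s u : H) - u‖ ^ 2 ≤ s * Metric.diam C ^ 2 / a := by
  have hφ := continuous_orbit hc x
  set φ : ℝ → H := fun t => (T t.toNNReal x : H) with hφdef
  have hg : Continuous fun t => ‖φ t - (T s u : H)‖ ^ 2 := by fun_prop
  have hh : Continuous fun t => ‖φ t - (u : H)‖ ^ 2 := by fun_prop
  have hvar := integral_norm_sub_sq_eq hφ ha hu (T s u : H)
  have hsplit := intervalIntegral.integral_add_adjacent_intervals
    (hg.intervalIntegrable (μ := MeasureTheory.volume) 0 s) (hg.intervalIntegrable s a)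
  have h1 : ∫ t in (0 : ℝ)..s, ‖φ t - (T s u : H)‖ ^ 2 ≤ s * Metric.diam C ^ 2 := by
    have := intervalIntegral.integral_mono_on (μ := MeasureTheory.volume) s.2
      (hg.intervalIntegrable 0 s)
      (continuous_const (y := Metric.diam C ^ 2) |>.intervalIntegrable 0 s) fun t _ => by
        have := Metric.dist_le_diam_of_mem hC.isBounded (T t.toNNReal x).2 (T s u).2
        rw [dist_eq_norm] at this
        gcongr
    simpa using this
  -- Shift the variable by `s`: the point `φ (t + s)` is `T s (φ t)`.
  have h2 : ∫ t in (s : ℝ)..a, ‖φ t - (T s u : H)‖ ^ 2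
      ≤ ∫ t in (0 : ℝ)..(a - s), ‖φ t - (u : H)‖ ^ 2 := by
    have hshift := intervalIntegral.integral_comp_add_right (a := 0) (b := a - s)
      (fun t => ‖φ t - (T s u : H)‖ ^ 2) (s : ℝ)
    rw [zero_add, sub_add_cancel] at hshift
    rw [← hshift]
    refine intervalIntegral.integral_mono_on (sub_nonneg.2 hs)
      (Continuous.intervalIntegrable (by fun_prop) _ _) (hh.intervalIntegrable _ _) fun t ht => ?_
    have : T (t + s).toNNReal x = T s (T t.toNNReal x) := by
      rw [← hT.map_add, Real.toNNReal_add ht.1 s.coe_nonneg, Real.toNNReal_coe, add_comm]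
    simp only [hφdef, this]
    gcongr
    exact hT.nonexpansive s _ _
  have h3 : ∫ t in (0 : ℝ)..(a - s), ‖φ t - (u : H)‖ ^ 2
      ≤ ∫ t in (0 : ℝ)..a, ‖φ t - (u : H)‖ ^ 2 :=
    intervalIntegral.integral_mono_interval le_rfl (sub_nonneg.2 hs) (sub_le_self _ s.2)
      (Eventually.of_forall fun t => sq_nonneg _) (hh.intervalIntegrable _ _)
  rw [le_div_iff₀ ha, norm_sub_rev]
  linarith

/-! ### The implicit scheme -/

theorem existsUnique_isImplicitPoint (hne : C.Nonempty) (hC : IsCompact C) (hconv : Convex ℝ C)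
    (hT : IsNonexpansiveRep T) (hc : ∀ x, Continuous fun t => T t x) {K : ℝ≥0} {f : C → C}
    (hf : ContractingWith K f) {ε a : ℝ} (hε : ε ∈ Set.Ioo (0 : ℝ) 1) (ha : 0 < a) :
    ∃! w : C, IsImplicitPoint f T ε a w := by
  have := isCompact_iff_compactSpace.1 hC
  have := hne.to_subtype
  have hε1 : 0 < 1 - ε := sub_pos.2 hε.2
  let G : C → C := fun w => ⟨ε • (f w : H) + (1 - ε) • integralMean T a w,
    hconv (f w).2 (integralMean_mem hC hconv hc ha w) hε.1.le hε1.le (by ring)⟩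
  have hK : (K : ℝ) < 1 := hf.1
  have hG : ContractingWith (ε * K + (1 - ε)).toNNReal G := by
    refine ⟨by rw [Real.toNNReal_lt_one]; nlinarith [hε.1],
      LipschitzWith.of_dist_le_mul fun x y => ?_⟩
    have hεK := mul_nonneg hε.1.le K.coe_nonneg
    rw [Real.coe_toNNReal _ (by linarith), Subtype.dist_eq, Subtype.dist_eq, dist_eq_norm,
      dist_eq_norm]
    calc ‖(G x : H) - G y‖
        = ‖ε • ((f x : H) - f y) + (1 - ε) • (integralMean T a x - integralMean T a y)‖ := by
          congr 1
          simp only [G]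
          module
      _ ≤ ε * ‖(f x : H) - f y‖ + (1 - ε) * ‖integralMean T a x - integralMean T a y‖ := by
          refine (norm_add_le _ _).trans_eq ?_
          rw [norm_smul, norm_smul, Real.norm_of_nonneg hε.1.le, Real.norm_of_nonneg hε1.le]
      _ ≤ ε * (K * ‖(x : H) - y‖) + (1 - ε) * ‖(x : H) - y‖ := by
          gcongr
          · exact hε.1.le
          · exact hf.norm_coe_sub_le x y
          · exact norm_integralMean_sub_le hT hc ha x y
      _ = _ := by ring
  refine ⟨ContractingWith.fixedPoint G hG, ?_, fun w hw => ?_⟩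
  · exact congrArg Subtype.val hG.fixedPoint_isFixedPt.symm
  · exact hG.fixedPoint_unique (Subtype.ext hw.symm)

/-- The mean is nonexpansive and fixes `q`, so moving from `w` to the mean of its orbit
does not lead away from `q`; the implicit equation turns this into a variational inequality. -/
theorem inner_le_zero_of_isImplicitPoint (hT : IsNonexpansiveRep T)
    (hc : ∀ x, Continuous fun t => T t x) {f : C → C} {ε a : ℝ} (hε : ε ∈ Set.Ioo (0 : ℝ) 1)
    (ha : 0 < a) {w q : C} (hw : IsImplicitPoint f T ε a w) (hq : q ∈ commonFix T) :
    ⟪(f w : H) - w, (q : H) - w⟫ ≤ 0 := by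
  have h1 := norm_integralMean_sub_le hT hc ha w q
  rw [integralMean_of_mem_commonFix ha hq] at h1
  have h2 := real_inner_le_norm (integralMean T a w - q) ((w : H) - q)
  have h3 : ‖integralMean T a w - q‖ * ‖(w : H) - q‖ ≤ ‖(w : H) - q‖ * ‖(w : H) - q‖ := by
    gcongr
  have h4 : ⟪integralMean T a w - w, (w : H) - q⟫ ≤ 0 := by
    rw [show integralMean T a w - w = (integralMean T a w - q) - ((w : H) - q) by abel,
      inner_sub_left, real_inner_self_eq_norm_mul_norm]
    linarith
  have h5 : ε • ((f w : H) - w) = -((1 - ε) • (integralMean T a w - w)) := by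
    have hw' : (w : H) = ε • (f w : H) + (1 - ε) • integralMean T a w := hw
    have : ε • ((f w : H) - w) + (1 - ε) • (integralMean T a w - w)
        = (ε • (f w : H) + (1 - ε) • integralMean T a w) - w := by module
    rw [eq_neg_iff_add_eq_zero, this, ← hw', sub_self]
  have h6 : ε * ⟪(f w : H) - w, (q : H) - w⟫
      = (1 - ε) * ⟪integralMean T a w - w, (w : H) - q⟫ := by
    rw [← real_inner_smul_left, h5, ← neg_sub (w : H) q, inner_neg_neg, real_inner_smul_left]
  have h7 := mul_nonpos_of_nonneg_of_nonpos (sub_pos.2 hε.2).le h4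
  rw [← h6] at h7
  exact nonpos_of_mul_nonpos_right h7 hε.1

theorem norm_apply_sub_le_of_isImplicitPoint (hC : IsCompact C) (hconv : Convex ℝ C)
    (hT : IsNonexpansiveRep T) (hc : ∀ x, Continuous fun t => T t x) {f : C → C} {ε a : ℝ}
    (hε : ε ∈ Set.Ioo (0 : ℝ) 1) (ha : 0 < a) (s : ℝ≥0) (hs : (s : ℝ) ≤ a) {w : C}
    (hw : IsImplicitPoint f T ε a w) :
    ‖(T s w : H) - w‖ ≤ 2 * (ε * Metric.diam C) + √(s * Metric.diam C ^ 2 / a) := by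
  let u : C := ⟨integralMean T a w, integralMean_mem hC hconv hc ha w⟩
  have h1 : ‖(T s u : H) - u‖ ≤ √(s * Metric.diam C ^ 2 / a) :=
    Real.le_sqrt_of_sq_le (norm_apply_integralMean_sub_sq_le hC hT hc ha s hs w u rfl)
  have h2 : ‖(w : H) - u‖ ≤ ε * Metric.diam C := by
    have hw' : (w : H) = ε • (f w : H) + (1 - ε) • (u : H) := hw
    have h3 : (w : H) - u = ε • ((f w : H) - u) := by
      rw [hw']
      module
    rw [h3, norm_smul, Real.norm_of_nonneg hε.1.le, ← dist_eq_norm]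
    gcongr
    · exact hε.1.le
    · exact Metric.dist_le_diam_of_mem hC.isBounded (f w).2 u.2
  calc ‖(T s w : H) - w‖
      = ‖((T s w : H) - T s u) + ((T s u : H) - u) - ((w : H) - u)‖ := by congr 1; abel
    _ ≤ ‖(T s w : H) - T s u‖ + ‖(T s u : H) - u‖ + ‖(w : H) - u‖ :=
        (norm_sub_le _ _).trans (add_le_add_left (norm_add_le _ _) _)
    _ ≤ ‖(w : H) - u‖ + ‖(T s u : H) - u‖ + ‖(w : H) - u‖ := by
        gcongr
        exact hT.nonexpansive s w u
    _ ≤ _ := by linarith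

theorem tendsto_of_isImplicitPoint (hC : IsCompact C) (hconv : Convex ℝ C)
    (hT : IsNonexpansiveRep T) (hc : ∀ x, Continuous fun t => T t x) {f : C → C}
    (hf : Continuous f) {ε a : ℕ → ℝ} (hε : ∀ n, ε n ∈ Set.Ioo (0 : ℝ) 1)
    (hεlim : Tendsto ε atTop (𝓝 0)) (ha : ∀ n, 0 < a n) (halim : Tendsto a atTop atTop)
    {z : ℕ → C} (hz : ∀ n, IsImplicitPoint f T (ε n) (a n) (z n)) {p : C}
    (hp : ∀ c, IsNearest (commonFix T) (f c) c → c = p) :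
    Tendsto z atTop (𝓝 p) := by
  have := isCompact_iff_compactSpace.1 hC
  refine isCompact_univ.tendsto_nhds_of_unique_mapClusterPt
    (Eventually.of_forall fun _ => Set.mem_univ _) fun c _ hcl => hp c ⟨fun s => ?_, fun q hq => ?_⟩
  · have hsmall : Tendsto (fun n => (T s (z n) : H) - z n) atTop (𝓝 0) := by
      have hlim : Tendsto (fun n => 2 * (ε n * Metric.diam C)
          + √(s * Metric.diam C ^ 2 / a n)) atTop (𝓝 0) := by
        have h1 := (hεlim.mul_const (Metric.diam C)).const_mul 2
        have h2 := (halim.const_div_atTop (s * Metric.diam C ^ 2)).sqrt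
        simpa using h1.add h2
      exact squeeze_zero_norm' ((halim.eventually_ge_atTop (s : ℝ)).mono fun n hn =>
        norm_apply_sub_le_of_isImplicitPoint hC hconv hT hc (hε n) (ha n) s hn (hz n)) hlim
    have hcont : Continuous fun w : C => (T s w : H) - w :=
      (continuous_subtype_val.comp (hT.continuous s)).sub continuous_subtype_val
    have hcl' : MapClusterPt ((T s c : H) - c) atTop fun n => (T s (z n) : H) - z n :=
      hcl.continuousAt_comp hcont.continuousAt
    have : (𝓝 ((T s c : H) - c) ⊓ 𝓝 0).NeBot := ClusterPt.mono hcl' hsmall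
    exact Subtype.ext (sub_eq_zero.1 (eq_of_nhds_neBot this))
  · have hcl' : IsClosed {w : C | ⟪(f w : H) - w, (q : H) - w⟫ ≤ 0} :=
      isClosed_le (by fun_prop) continuous_const
    exact hcl'.mem_of_mapClusterPt hcl (Eventually.of_forall fun n =>
      inner_le_zero_of_isImplicitPoint hT hc (hε n) (ha n) (hz n) hq)

end Hilbert

/-! ### Families of representations -/

theorem corollary4p2 {I : Type*} [Nonempty I]
    {H : Type*} [NormedAddCommGroup H] [InnerProductSpace ℝ H] [CompleteSpace H]
    (C : I → Set H)
    (hCne : ∀ i, (C i).Nonempty) (hCcomp : ∀ i, IsCompact (C i)) (hCconv : ∀ i, Convex ℝ (C i))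
    (T : ∀ i, ℝ≥0 → C i → C i)
    (hT : ∀ i, IsNonexpansiveRep (T i))
    (hFix : ∀ i, (commonFix (T i)).Nonempty)
    (X : Submodule ℝ (ℝ≥0 →ᵇ ℝ)) (hXinv : IsLeftInvariantSubspace X) (hXone : 1 ∈ X)
    (hXT : ∀ (i : I) (x : C i) (y : H), ∃ g ∈ X, ∀ t, g t = ⟪(T i t x : H), y⟫)
    (α : I → ℝ≥0) (f : ∀ i, C i → C i) (hf : ∀ i, ContractingWith (α i) (f i))
    (ε : ℕ → ℝ) (hε : ∀ n, ε n ∈ Set.Ioo (0 : ℝ) 1)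
    (hεlim : Filter.Tendsto ε Filter.atTop (nhds 0))
    (a : ℕ → ℝ) (ha : ∀ n, 0 < a n) (halim : Filter.Tendsto a Filter.atTop Filter.atTop) :
    ∃ (P : ∀ i, C i → C i) (x : ∀ i, C i),
      -- `P i` is the unique sunny nonexpansive retraction of `C i` onto the common fixed points
      (∀ i, IsSunnyNonexpansiveRetraction (commonFix (T i)) (P i) ∧
        ∀ Q : C i → C i, IsSunnyNonexpansiveRetraction (commonFix (T i)) Q → Q = P i) ∧
      -- `x i` is the unique fixed point of `f i ∘ P i` in `C i`
      (∀ i, f i (P i (x i)) = x i ∧ ∀ y : C i, f i (P i y) = y → y = x i) ∧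
      -- the scheme is well defined
      (∀ n i, ∃! w : C i, IsImplicitPoint (f i) (T i) (ε n) (a n) w) ∧
      -- and it converges in the product topology on `I → H`
      (∀ z : ∀ (_ : ℕ) (i : I), C i,
        (∀ n i, IsImplicitPoint (f i) (T i) (ε n) (a n) (z n i)) →
        Filter.Tendsto (fun (n : ℕ) (i : I) => (z n i : H)) Filter.atTop
          (nhds (fun i => (P i (x i) : H)))) := by
  have hc : ∀ i x, Continuous fun t => T i t x := fun i x => by
    refine continuous_of_forall_continuous_inner (hCcomp i) fun y => ?_
    obtain ⟨g, -, hg⟩ := hXT i x y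
    exact (funext hg : ⇑g = _) ▸ g.continuous
  have hnear : ∀ i (x : C i), ∃ p, IsNearest (commonFix (T i)) (x : H) p := fun i x =>
    exists_isNearest (hFix i) (isComplete_commonFix (hCcomp i) (hT i))
      (convex_commonFix (hCconv i) (hT i)) x
  choose P hP using hnear
  have hsunny := fun i => isSunnyNonexpansiveRetraction_of_isNearest (hP i)
  have hfP : ∀ i, ContractingWith (α i) (f i ∘ P i) := fun i => by
    have hLip : LipschitzWith 1 (P i) := LipschitzWith.of_dist_le_mul fun x y => by
      simpa [Subtype.dist_eq, dist_eq_norm] using (hsunny i).nonexpansive x y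
    exact ⟨(hf i).1, by simpa using (hf i).2.comp hLip⟩
  have hex : ∀ i, ∃ x : C i, f i (P i x) = x ∧ ∀ y : C i, f i (P i y) = y → y = x := fun i => by
    have := isCompact_iff_compactSpace.1 (hCcomp i)
    have := (hCne i).to_subtype
    exact ⟨ContractingWith.fixedPoint _ (hfP i), (hfP i).fixedPoint_isFixedPt,
      fun y hy => (hfP i).fixedPoint_unique hy⟩
  choose x hx using hex
  refine ⟨P, x, fun i => ⟨hsunny i, fun Q hQ => ?_⟩, hx, fun n i => ?_, fun z hz => ?_⟩
  · exact funext fun y => (hQ.isNearest (hCconv i) y).eq (hP i y)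
  · exact existsUnique_isImplicitPoint (hCne i) (hCcomp i) (hCconv i) (hT i) (hc i) (hf i)
      (hε n) (ha n)
  · refine tendsto_pi_nhds.2 fun i => (continuous_subtype_val.tendsto _).comp ?_
    refine tendsto_of_isImplicitPoint (hCcomp i) (hCconv i) (hT i) (hc i)
      (hf i).toLipschitzWith.continuous hε hεlim ha halim (fun n => hz n i) fun c hcn => ?_
    -- If `c = P (f c)`, then `f c` is a fixed point of `f ∘ P`, so it is `x i`.
    have hcP : P i (f i c) = c := (hP i _).eq hcn
    rw [← (hx i).2 (f i c) (by rw [hcP]), hcP]
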